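/- For $p\in(0,1)$ let $\mathrm{Geo}(p)$ be the distribution on $\{1,2,\dots\}$ with mass $p(1-p)^{j-1}$ at $j$. Let $X_1,X_2,\dots$ be independent $\mathrm{Geo}(p)$ random variables, let $\Pi_1,\Pi_2,\dots$ be the distinct values of the sequence $(X_n)$ in order of first appearance (the $\mathrm{Geo}(p)$-biased permutation), and let $K=K_p=\inf\{k\ge 1:\ \Pi \text{ restricts to a permutation of } \{1,\dots,k\}\}$ be its first block size ($K=\infty$ if there is no such $k$). Let $$b=\log 2-\int_0^\infty \log\bigl(1-2^{-e^{y}}\bigr)\,dy ,$$ where the integral converges absolutely. Then for every $p\in(0,1)$ the block size $K$ is stochastically dominated by a $\mathrm{Geo}(p\,e^{-b/p})$ random variable $G$, that is, $\mathbf P[K>t]\le \mathbf P[G>t]$ for all $t$. In particular, $\mathbf E K\le \frac1p e^{b/p}$ for every $p\in(0,1)$, and for every $\epsilon>0$, $$\mathbf P\bigl[K_p>e^{(b+\epsilon)/p}\bigr]\to 0\qquad\text{as } p\downarrow 0 .$$ -/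

import Mathlib

open MeasureTheory ProbabilityTheory Filter Topology
open scoped ENNReal

/-- The geometric distribution `Geo(p)` on the positive integers:
mass `p (1 - p) ^ (j - 1)` at each `j ≥ 1` (the sum runs over `i = j - 1`). -/
noncomputable def geoMeasure (p : ℝ) : Measure ℕ :=
  Measure.sum fun i : ℕ => ENNReal.ofReal (p * (1 - p) ^ i) • Measure.dirac (i + 1)

/-- `X 0, X 1, X 2, …` are independent random variables with common law `ν`
on a probability space `(Ω, P)`. -/
structure IsIIDSample {Ω : Type*} [MeasurableSpace Ω] (ν : Measure ℕ) (P : Measure Ω)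
    (X : ℕ → Ω → ℕ) : Prop where
  isProb : IsProbabilityMeasure P
  indep : iIndepFun X P
  law : ∀ n, HasLaw (X n) ν P

/-- The values of the sequence `x 0, x 1, …` in order of first appearance, without repetition,
indexed by `i = 1, 2, …`: the `i`-th one is `x n` for the `i`-th index `n` at which a new value
appears. (If `x` takes fewer than `i` values, then `Nat.nth` returns `0`, so that a value is
repeated and the map is not injective on `{1, …, i}`.) -/
noncomputable def appearancePerm (x : ℕ → ℕ) (i : ℕ) : ℕ :=
  x (Nat.nth (fun n => ∀ m < n, x m ≠ x n) (i - 1))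

/-- The size of the first block of a map `π`: the least `k ≥ 1` such that `π` restricts to a
permutation of `{1, …, k}`, and `∞` if there is none. -/
noncomputable def firstBlockSize (π : ℕ → ℕ) : ℕ∞ :=
  ⨅ (k : ℕ) (_ : 1 ≤ k ∧ Set.BijOn π (Set.Icc 1 k) (Set.Icc 1 k)), (k : ℕ∞)

/-- The random first block size `K` of the biased permutation read off from `X`. -/
noncomputable def blockSize {Ω : Type*} (X : ℕ → Ω → ℕ) (ω : Ω) : ℕ∞ :=
  firstBlockSize (appearancePerm fun n => X n ω)

/-- `Y` (defined under `P`) is stochastically dominated by `Z` (defined under `Q`). -/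
def StochDominated {Ω Ω' α : Type*} [MeasurableSpace Ω] [MeasurableSpace Ω'] [LinearOrder α]
    (P : Measure Ω) (Y : Ω → α) (Q : Measure Ω') (Z : Ω' → α) : Prop :=
  ∀ t : α, P {ω | t < Y ω} ≤ Q {ω | t < Z ω}

/-- The constant `b = log 2 - ∫₀^∞ log (1 - 2 ^ (-e ^ y)) dy`. -/
noncomputable def blockConst : ℝ :=
  Real.log 2 - ∫ y in Set.Ioi (0 : ℝ), Real.log (1 - (2 : ℝ) ^ (-Real.exp y))

/-!
Call `k` a *renewal* of a sequence `x` if the letters before the first one larger than `k` are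
exactly `1, …, k`. Then the values of `x` in order of first appearance begin with a permutation of
`{1, …, k}` (`bijOn_appearancePerm`), so the first block size is at most the first positive renewal,
and it suffices to bound the tail of the latter for the law `iidLaw` of an independent sequence.

Let `u n` be the probability that `n` is a renewal. Attaching independent exponential clocks to the
letters gives (`iidLaw_clears`, `iidLaw_clears_Ioc`), with time scaled so that the clock of the
letters larger than `n` has rate one,
`u n = ∫₀^∞ e ^ (-s) * ∏_{i < n} (1 - exp (-s * p / (1 - p) ^ (i + 1))) ds`.
Since the letters larger than `k`, shifted by `k`, form again a `Geo(p)` sample, renewals regenerate,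
and with `f k` the probability that `k` is the first positive renewal,
`u n = ∑_{1 ≤ k ≤ n} f k * u (n - k)` (`renewalProb_succ_eq_sum`).

The heart of the matter is a lower bound on the hazard rate of the first renewal:
`f (n + 1) ≥ p * u (n + 1) * (1 - ∑_{k ≤ n} f k)` (`hazard_ge`). Log-convexity of `u` alone would
give `f ≥ 0` (Kaluza's theorem); the stronger conclusion comes from the stronger inequality
`u (m + 1) / u (m + 2) - 1 ≤ (1 - p) * (u m / u (m + 1) - 1)` (`renewalProb_sq_le`), which follows
from the integral formula by the Cauchy-Schwarz inequality and the convexity of `exp`.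

Finally, `u n ≥ exp (-b / p)` (`exp_neg_blockConst_div_le`): restrict the integral to
`s ≥ log 2 / p`, bound `1 / (1 - p) ^ i` below by `exp (p * i)`, and compare the sum of the
logarithms of the factors with the integral in the definition of `b`. So the hazard rate is at least
`p * exp (-b / p)`, which is the stochastic domination; summing the tail bounds the expectation, and
Markov's inequality gives the limit.
-/

/-! ### Sequences of independent letters -/

/-- The sequence `a, x 0, x 1, …`. -/
def consSeq (a : ℕ) (x : ℕ → ℕ) : ℕ → ℕ
  | 0 => a
  | i + 1 => x i

@[simp] lemma consSeq_zero (a : ℕ) (x : ℕ → ℕ) : consSeq a x 0 = a := rfl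

@[simp] lemma consSeq_succ (a : ℕ) (x : ℕ → ℕ) (i : ℕ) : consSeq a x (i + 1) = x i := rfl

lemma measurable_consSeq : Measurable fun z : ℕ × (ℕ → ℕ) => consSeq z.1 z.2 := by
  refine measurable_pi_iff.2 fun i => ?_
  cases i with
  | zero => exact measurable_fst
  | succ i => exact (measurable_pi_apply i).comp measurable_snd

/-- The law of an independent sequence with common law `ν`. -/
noncomputable abbrev iidLaw (ν : Measure ℕ) : Measure (ℕ → ℕ) :=
  Measure.infinitePi fun _ => ν

lemma map_consSeq (ν : Measure ℕ) [IsProbabilityMeasure ν] :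
    (ν.prod (iidLaw ν)).map (fun z => consSeq z.1 z.2) = iidLaw ν := by
  refine Measure.eq_infinitePi _ fun s t ht => ?_
  -- replacing the sets outside `s` by the whole space, the box is a product over an initial segment
  obtain ⟨N, hN⟩ : ∃ N, s ⊆ Finset.range (N + 1) :=
    ⟨s.sup id, fun i hi => Finset.mem_range.2 (Nat.lt_succ_of_le (Finset.le_sup (f := id) hi))⟩
  classical
  set t' : ℕ → Set ℕ := fun i => if i ∈ s then t i else Set.univ with ht'
  have h1 : (s : Set ℕ).pi t = (Finset.range (N + 1) : Set ℕ).pi t' := by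
    ext x
    simp only [Set.mem_pi, ht', Finset.mem_coe]
    constructor
    · intro h i _
      by_cases his : i ∈ s <;> simp [his, h]
    · intro h i hi
      simpa [hi] using h i (hN hi)
  have h2 : ∏ i ∈ s, ν (t i) = ∏ i ∈ Finset.range (N + 1), ν (t' i) := by
    rw [← Finset.prod_subset hN]
    · exact Finset.prod_congr rfl fun i hi => by simp [ht', hi]
    · intro i _ hi
      simp [ht', hi]
  have h3 : (fun z : ℕ × (ℕ → ℕ) => consSeq z.1 z.2) ⁻¹' (Finset.range (N + 1) : Set ℕ).pi t' =
      t' 0 ×ˢ (Finset.range N : Set ℕ).pi fun i => t' (i + 1) := by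
    ext ⟨a, x⟩
    simp only [Set.mem_preimage, Set.mem_pi, Finset.coe_range, Set.mem_Iio, Set.mem_prod]
    constructor
    · intro h
      exact ⟨h 0 (by omega), fun i hi => h (i + 1) (by omega)⟩
    · rintro ⟨h0, h⟩ i hi
      cases i with
      | zero => exact h0
      | succ i => exact h i (by omega)
  rw [h1, h2, Measure.map_apply measurable_consSeq
    (MeasurableSet.pi (Set.to_countable _) fun i _ => .of_discrete), h3, Measure.prod_prod,
    Measure.infinitePi_pi _ fun i _ => .of_discrete, Finset.prod_range_succ', mul_comm]

lemma iidLaw_apply_eq_lintegral (ν : Measure ℕ) [IsProbabilityMeasure ν] {S : Set (ℕ → ℕ)}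
    (hS : MeasurableSet S) :
    iidLaw ν S = ∫⁻ a, iidLaw ν {x | consSeq a x ∈ S} ∂ν := by
  conv_lhs => rw [← map_consSeq ν, Measure.map_apply measurable_consSeq hS,
    Measure.prod_apply (measurable_consSeq hS)]
  rfl

lemma measurableSet_head_tail (D : Set ℕ) {E : Set (ℕ → ℕ)} (hE : MeasurableSet E) :
    MeasurableSet {x : ℕ → ℕ | x 0 ∈ D ∧ (fun i => x (i + 1)) ∈ E} :=
  (measurable_pi_apply 0 (MeasurableSet.of_discrete (s := D))).inter
    ((measurable_pi_iff.2 fun i => measurable_pi_apply (i + 1)) hE)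

/-- First-step analysis for an event which depends on the first letter through a set `D`. -/
lemma iidLaw_head_tail (ν : Measure ℕ) [IsProbabilityMeasure ν] (D : Set ℕ) {E : Set (ℕ → ℕ)}
    (hE : MeasurableSet E) :
    iidLaw ν {x | x 0 ∈ D ∧ (fun i => x (i + 1)) ∈ E} = ν D * iidLaw ν E := by
  rw [iidLaw_apply_eq_lintegral ν (measurableSet_head_tail D hE)]
  have : ∀ a, iidLaw ν {x | consSeq a x ∈ {x : ℕ → ℕ | x 0 ∈ D ∧ (fun i => x (i + 1)) ∈ E}} =
      D.indicator (fun _ => iidLaw ν E) a := by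
    intro a
    by_cases ha : a ∈ D <;> simp [ha]
    rfl
  simp_rw [this]
  rw [lintegral_indicator_const .of_discrete, mul_comm]

/-- An event `C` which depends on the first `m` letters only is independent of any event about
the letters from position `m` on. -/
lemma iidLaw_prefix_inter_shift (ν : Measure ℕ) [IsProbabilityMeasure ν] (m : ℕ) :
    ∀ {C E : Set (ℕ → ℕ)}, MeasurableSet C → MeasurableSet E →
      (∀ x y : ℕ → ℕ, (∀ i < m, x i = y i) → x ∈ C → y ∈ C) →
      iidLaw ν (C ∩ {x | (fun i => x (i + m)) ∈ E}) = iidLaw ν C * iidLaw ν E := by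
  induction m with
  | zero =>
    intro C E hC hE hdep
    rcases C.eq_empty_or_nonempty with rfl | ⟨x, hx⟩
    · simp
    · obtain rfl : C = Set.univ := Set.eq_univ_of_forall fun y => hdep x y (by simp) hx
      simp
      rfl
  | succ m ih =>
    intro C E hC hE hdep
    have hsh : MeasurableSet {x : ℕ → ℕ | (fun i => x (i + (m + 1))) ∈ E} :=
      (measurable_pi_iff.2 fun i => measurable_pi_apply (i + (m + 1))) hE
    have hcons : ∀ a, Measurable (consSeq a) := fun a =>
      measurable_consSeq.comp measurable_prodMk_left
    rw [iidLaw_apply_eq_lintegral ν (hC.inter hsh), iidLaw_apply_eq_lintegral ν hC,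
      ← lintegral_mul_const _ Measurable.of_discrete]
    refine lintegral_congr fun a => ?_
    rw [← ih (C := {x | consSeq a x ∈ C}) (hcons a hC) hE]
    · rfl
    · intro x y hxy hx
      refine hdep _ _ (fun i hi => ?_) hx
      cases i with
      | zero => rfl
      | succ i => exact hxy i (by omega)

/-! ### The exponential clock formula -/

/-- The set of sequences in which the letters before the first one larger than `n` all lie in
`{1, …, n} \ A` and include every element of `B`. -/
def Clears (n : ℕ) (A B : Finset ℕ) : Set (ℕ → ℕ) :=
  {x | ∃ m, (∀ i < m, x i ∈ Finset.Icc 1 n \ A) ∧ n < x m ∧ ∀ j ∈ B, ∃ i < m, x i = j}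

lemma measurableSet_clears (n : ℕ) (A B : Finset ℕ) : MeasurableSet (Clears n A B) := by
  have h : ∀ (i : ℕ) (q : ℕ → Prop), Measurable fun x : ℕ → ℕ => q (x i) := fun i q =>
    (Measurable.of_discrete (f := q)).comp (measurable_pi_apply i)
  refine measurableSet_setOfPred.2 (Measurable.exists fun m => ?_)
  refine (Measurable.forall fun i => Measurable.imp measurable_const
    (h i fun a => a ∈ Finset.Icc 1 n \ A)).and ((h m fun a => n < a).and ?_)
  exact Measurable.forall fun j => Measurable.imp measurable_const
    (Measurable.exists fun i => Measurable.and measurable_const (h i fun a => a = j))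

lemma clears_insert_right (n j : ℕ) (A B : Finset ℕ) :
    Clears n A (insert j B) = Clears n A B \ Clears n (insert j A) B := by
  ext x
  constructor
  · rintro ⟨m, h1, h2, h3⟩
    refine ⟨⟨m, h1, h2, fun i hi => h3 i (Finset.mem_insert_of_mem hi)⟩, ?_⟩
    rintro ⟨m', h1', h2', -⟩
    obtain ⟨i, hi, rfl⟩ := h3 j (Finset.mem_insert_self _ _)
    by_cases him : i < m'
    · have := h1' i him
      simp at this
    · have := h1 m' (by omega)
      simp at this
      omega
  · rintro ⟨⟨m, h1, h2, h3⟩, hn⟩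
    refine ⟨m, h1, h2, fun l hl => ?_⟩
    rcases Finset.mem_insert.1 hl with rfl | hl
    · by_contra! hc
      refine hn ⟨m, fun i hi => ?_, h2, h3⟩
      have := h1 i hi
      have := hc i hi
      simp_all
    · exact h3 l hl

lemma clears_insert_left_subset (n j : ℕ) (A B : Finset ℕ) :
    Clears n (insert j A) B ⊆ Clears n A B := by
  rintro x ⟨m, h1, h2, h3⟩
  refine ⟨m, fun i hi => ?_, h2, h3⟩
  have := h1 i hi
  simp_all

lemma clears_empty_eq (n : ℕ) (A : Finset ℕ) :
    Clears n A ∅ = {x | x 0 ∈ Set.Ioi n ∧ (fun i => x (i + 1)) ∈ Set.univ} ∪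
      {x | x 0 ∈ (↑(Finset.Icc 1 n \ A) : Set ℕ) ∧ (fun i => x (i + 1)) ∈ Clears n A ∅} := by
  ext x
  constructor
  · rintro ⟨m, h1, h2, -⟩
    cases m with
    | zero => exact Or.inl ⟨h2, trivial⟩
    | succ m =>
      exact Or.inr ⟨h1 0 (by omega), m, fun i hi => h1 (i + 1) (by omega), h2, by simp⟩
  · rintro (⟨h, -⟩ | ⟨h0, m, h1, h2, -⟩)
    · exact ⟨0, by simp, h, by simp⟩
    · refine ⟨m + 1, fun i hi => ?_, h2, by simp⟩
      cases i with
      | zero => exact h0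
      | succ i => exact h1 i (by omega)

/-- Until the first letter larger than `n`, the letters of `A` fail to appear with probability
`τ / (τ + ν A)`, where `τ = ν (n, ∞)`. -/
lemma iidLaw_clears_empty (ν : Measure ℕ) [IsProbabilityMeasure ν] (h0 : ν.real {0} = 0) {n : ℕ}
    (hτ : ν.real (Set.Ioi n) ≠ 0) {A : Finset ℕ} (hA : A ⊆ Finset.Icc 1 n) :
    (iidLaw ν).real (Clears n A ∅) = 1 / (1 + ∑ j ∈ A, ν.real {j} / ν.real (Set.Ioi n)) := by
  classical
  set τ := ν.real (Set.Ioi n)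
  set D : Set ℕ := ↑(Finset.Icc 1 n \ A)
  have hτ0 : 0 < τ := lt_of_le_of_ne measureReal_nonneg hτ.symm
  have hsum : ν.real D + ∑ j ∈ A, ν.real {j} + τ = 1 := by
    have e1 : (Set.univ : Set ℕ) = ({0} ∪ (D ∪ ↑A)) ∪ Set.Ioi n := by
      ext i
      have : i ∈ A → 1 ≤ i ∧ i ≤ n := fun h => Finset.mem_Icc.1 (hA h)
      simp [D]
      by_cases hi : i ∈ A <;> simp [hi] <;> omega
    have d1 : Disjoint D (A : Set ℕ) := by
      exact Finset.disjoint_coe.2 (Finset.sdiff_disjoint : Disjoint (Finset.Icc 1 n \ A) A)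
    have d2 : Disjoint ({0} : Set ℕ) (D ∪ ↑A) := by
      simp only [Set.disjoint_singleton_left, Set.mem_union, not_or, D]
      refine ⟨by simp, fun h => by simpa using hA h⟩
    have d3 : Disjoint (({0} : Set ℕ) ∪ (D ∪ ↑A)) (Set.Ioi n) := by
      rw [Set.disjoint_left]
      rintro i hi (hin : n < i)
      have : i ∈ A → 1 ≤ i ∧ i ≤ n := fun h => Finset.mem_Icc.1 (hA h)
      simp only [D, Set.mem_union, Set.mem_singleton_iff, Finset.mem_coe, Finset.mem_sdiff,
        Finset.mem_Icc] at hi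
      rcases hi with rfl | ⟨hi, -⟩ | hi
      · omega
      · omega
      · have := this hi
        omega
    have := probReal_univ (μ := ν)
    rw [e1, measureReal_union d3 .of_discrete, measureReal_union d2 .of_discrete,
      measureReal_union d1 .of_discrete, h0, ← sum_measureReal_singleton A] at this
    linarith
  have hstep : (iidLaw ν).real (Clears n A ∅) = τ + ν.real D * (iidLaw ν).real (Clears n A ∅) := by
    have hd : Disjoint {x : ℕ → ℕ | x 0 ∈ Set.Ioi n ∧ (fun i => x (i + 1)) ∈ Set.univ}
        {x | x 0 ∈ D ∧ (fun i => x (i + 1)) ∈ Clears n A ∅} := by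
      rw [Set.disjoint_left]
      rintro x ⟨h, -⟩ ⟨h', -⟩
      have := Finset.mem_Icc.1 (Finset.mem_sdiff.1 h').1
      exact absurd this.2 (not_le.2 h)
    have hm := measurableSet_head_tail D (measurableSet_clears n A ∅)
    conv_lhs => rw [clears_empty_eq, measureReal_union hd hm]
    simp only [measureReal_def]
    rw [iidLaw_head_tail ν _ .univ, iidLaw_head_tail ν _ (measurableSet_clears n A ∅)]
    simp [τ, D, measureReal_def]
  rw [← Finset.sum_div]
  have hS : 0 ≤ ∑ j ∈ A, ν.real {j} := Finset.sum_nonneg fun _ _ => measureReal_nonneg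
  field_simp
  linear_combination (iidLaw ν).real (Clears n A ∅) * hsum + hstep

/-- A bounded continuous function is integrable against the standard exponential law. -/
lemma integrableOn_exp_neg_mul {F : ℝ → ℝ} (hF : Continuous F) (h : ∀ s, 0 < s → |F s| ≤ 1) :
    IntegrableOn (fun s => Real.exp (-s) * F s) (Set.Ioi 0) := by
  refine Integrable.mono' (g := fun s => Real.exp (-s)) (integrableOn_exp_neg_Ioi 0)
    (by fun_prop) ?_
  filter_upwards [ae_restrict_mem measurableSet_Ioi] with s hs
  rw [norm_mul, Real.norm_eq_abs, Real.norm_eq_abs, abs_of_pos (Real.exp_pos _)]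
  exact mul_le_of_le_one_right (Real.exp_pos _).le (h s hs)

lemma one_sub_exp_neg_mem_Icc {x : ℝ} (hx : 0 ≤ x) : 1 - Real.exp (-x) ∈ Set.Icc 0 1 :=
  ⟨by simpa using hx, by linarith [Real.exp_pos (-x)]⟩

lemma prod_one_sub_exp_neg_mem_Icc {ι : Type*} (B : Finset ι) {α : ι → ℝ} (hα : ∀ j, 0 ≤ α j)
    {s : ℝ} (hs : 0 ≤ s) : ∏ j ∈ B, (1 - Real.exp (-(s * α j))) ∈ Set.Icc (0 : ℝ) 1 :=
  ⟨Finset.prod_nonneg fun j _ => (one_sub_exp_neg_mem_Icc (mul_nonneg hs (hα j))).1,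
    Finset.prod_le_one (fun j _ => (one_sub_exp_neg_mem_Icc (mul_nonneg hs (hα j))).1)
      fun j _ => (one_sub_exp_neg_mem_Icc (mul_nonneg hs (hα j))).2⟩

/-- The exponential clock formula: let the letters of `A` and `B` and the event "larger than `n`"
be attached to independent exponential clocks with rates their probabilities, relative to that of
the event "larger than `n`". Then `Clears n A B` has the probability that the clock of that event,
which rings at time `s`, rings after those of `B` and before those of `A`. -/
lemma iidLaw_clears (ν : Measure ℕ) [IsProbabilityMeasure ν] (h0 : ν.real {0} = 0) {n : ℕ}
    (hτ : ν.real (Set.Ioi n) ≠ 0) {α : ℕ → ℝ}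
    (hr : ∀ j, α j = ν.real {j} / ν.real (Set.Ioi n)) (B : Finset ℕ) :
    ∀ {A : Finset ℕ}, A ⊆ Finset.Icc 1 n → B ⊆ Finset.Icc 1 n → Disjoint A B →
    (iidLaw ν).real (Clears n A B) = ∫ s in Set.Ioi (0 : ℝ), Real.exp (-s) *
      (Real.exp (-(s * ∑ j ∈ A, α j)) * ∏ j ∈ B, (1 - Real.exp (-(s * α j)))) := by
  have hα : ∀ j, 0 ≤ α j := fun j => hr j ▸ div_nonneg measureReal_nonneg measureReal_nonneg
  have hint : ∀ A B : Finset ℕ, IntegrableOn (fun s : ℝ => Real.exp (-s) *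
      (Real.exp (-(s * ∑ j ∈ A, α j)) * ∏ j ∈ B, (1 - Real.exp (-(s * α j))))) (Set.Ioi 0) := by
    intro A B
    refine integrableOn_exp_neg_mul (by fun_prop) fun s hs => ?_
    have h1 := prod_one_sub_exp_neg_mem_Icc B hα hs.le
    have h2 : 0 ≤ s * ∑ j ∈ A, α j := mul_nonneg hs.le (Finset.sum_nonneg fun j _ => hα j)
    rw [abs_of_nonneg (mul_nonneg (Real.exp_pos _).le h1.1)]
    exact mul_le_one₀ (Real.exp_le_one_iff.2 (by linarith)) h1.1 h1.2
  induction B using Finset.induction_on with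
  | empty =>
    intro A hA _ _
    rw [iidLaw_clears_empty ν h0 hτ hA]
    simp_rw [← hr]
    have hS : 0 ≤ ∑ j ∈ A, α j := Finset.sum_nonneg fun j _ => hα j
    have : ∀ s : ℝ, Real.exp (-s) * (Real.exp (-(s * ∑ j ∈ A, α j)) *
        ∏ j ∈ ∅, (1 - Real.exp (-(s * α j)))) = Real.exp (-(1 + ∑ j ∈ A, α j) * s) := by
      intro s
      rw [Finset.prod_empty, mul_one, ← Real.exp_add]
      ring_nf
    simp_rw [this]
    rw [integral_exp_mul_Ioi (by linarith)]
    rw [mul_zero, Real.exp_zero, neg_div_neg_eq]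
  | insert j B hj ih =>
    intro A hA hB hd
    have hjA : j ∉ A := fun h => Finset.disjoint_left.1 hd h (Finset.mem_insert_self _ _)
    have hB' : B ⊆ Finset.Icc 1 n := (Finset.subset_insert _ _).trans hB
    have hd1 : Disjoint A B := hd.mono_right (Finset.subset_insert _ _)
    have hd2 : Disjoint (insert j A) B := Finset.disjoint_insert_left.2 ⟨hj, hd1⟩
    have hA2 : insert j A ⊆ Finset.Icc 1 n :=
      Finset.insert_subset (hB (Finset.mem_insert_self _ _)) hA
    rw [clears_insert_right, measureReal_sdiff (clears_insert_left_subset n j A B)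
      (measurableSet_clears _ _ _), ih hA hB' hd1, ih hA2 hB' hd2,
      ← integral_sub (hint _ _) (hint _ _)]
    refine integral_congr_ae (Eventually.of_forall fun s => ?_)
    simp only [Finset.sum_insert hjA, Finset.prod_insert hj, mul_add, neg_add, Real.exp_add]
    ring

/-! ### The renewal sequence and its hazard rates -/

/-- The probability that the letters `1, …, n` of a `Geo(p)` sample all appear before the first
larger letter, as an integral over the time `s` at which the clock of the larger letters rings.
The relative rate of the letter `n - i` is `p / (1 - p) ^ (i + 1)`. -/
noncomputable def renewalProb (p : ℝ) (n : ℕ) : ℝ :=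
  ∫ s in Set.Ioi (0 : ℝ), Real.exp (-s) *
    ∏ i ∈ Finset.range n, (1 - Real.exp (-(s * (p / (1 - p) ^ (i + 1)))))

section

variable {p : ℝ}

lemma relRate_pos (hp : p ∈ Set.Ioo (0 : ℝ) 1) (i : ℕ) : 0 < p / (1 - p) ^ (i + 1) :=
  div_pos hp.1 (pow_pos (sub_pos.2 hp.2) _)

lemma integrableOn_renewalProb (hp : p ∈ Set.Ioo (0 : ℝ) 1) (n : ℕ) :
    IntegrableOn (fun s : ℝ => Real.exp (-s) *
      ∏ i ∈ Finset.range n, (1 - Real.exp (-(s * (p / (1 - p) ^ (i + 1)))))) (Set.Ioi 0) := by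
  refine integrableOn_exp_neg_mul (by fun_prop) fun s hs => ?_
  have := prod_one_sub_exp_neg_mem_Icc (Finset.range n) (fun i => (relRate_pos hp i).le) hs.le
  rw [abs_of_nonneg this.1]
  exact this.2

lemma renewalProb_zero (p : ℝ) : renewalProb p 0 = 1 := by
  simp only [renewalProb, Finset.range_zero, Finset.prod_empty, mul_one]
  exact integral_exp_neg_Ioi_zero

lemma renewalProb_succ_le (hp : p ∈ Set.Ioo (0 : ℝ) 1) (n : ℕ) :
    renewalProb p (n + 1) ≤ renewalProb p n := by
  refine setIntegral_mono_on (integrableOn_renewalProb hp _) (integrableOn_renewalProb hp _)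
    measurableSet_Ioi fun s hs => ?_
  have h1 := prod_one_sub_exp_neg_mem_Icc (Finset.range n) (fun i => (relRate_pos hp i).le)
    (le_of_lt hs)
  have h2 := one_sub_exp_neg_mem_Icc (mul_nonneg (le_of_lt hs) (relRate_pos hp n).le)
  rw [Finset.prod_range_succ]
  exact mul_le_mul_of_nonneg_left (mul_le_of_le_one_right h1.1 h2.2) (Real.exp_pos _).le

/-- Strengthened log-convexity of the renewal sequence: the quantities `u m / u (m + 1) - 1`
decay at least by a factor `1 - p` in each step. -/
lemma renewalProb_sq_le (hp : p ∈ Set.Ioo (0 : ℝ) 1) (m : ℕ) (hpos : 0 < renewalProb p (m + 2)) :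
    renewalProb p (m + 1) ^ 2 ≤
      ((1 - p) * renewalProb p m + p * renewalProb p (m + 1)) * renewalProb p (m + 2) := by
  have hq : 0 < 1 - p := sub_pos.2 hp.2
  set u := renewalProb p
  -- the optimal slope for the tangent bound `1 / g ≥ 2 * t - t ^ 2 * g` below
  set t : ℝ := u (m + 1) / u (m + 2) with ht
  have key : 0 ≤ (1 - p) * u m + (p - 2 * t) * u (m + 1) + t ^ 2 * u (m + 2) := by
    set F : ℕ → ℝ → ℝ := fun n s => Real.exp (-s) *
      ∏ i ∈ Finset.range n, (1 - Real.exp (-(s * (p / (1 - p) ^ (i + 1))))) with hF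
    have hI : ∀ n (c : ℝ), IntegrableOn (fun s => c * F n s) (Set.Ioi 0) := fun n c =>
      (integrableOn_renewalProb hp n).const_mul c
    have e : (1 - p) * u m + (p - 2 * t) * u (m + 1) + t ^ 2 * u (m + 2) =
        ∫ s in Set.Ioi (0 : ℝ),
          ((1 - p) * F m s + (p - 2 * t) * F (m + 1) s + t ^ 2 * F (m + 2) s) := by
      have hI2 : IntegrableOn (fun s => (1 - p) * F m s + (p - 2 * t) * F (m + 1) s) (Set.Ioi 0) :=
        (hI m _).add (hI (m + 1) _)
      rw [integral_add hI2 (hI (m + 2) _),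
        integral_add (hI m _) (hI (m + 1) _), integral_const_mul, integral_const_mul,
        integral_const_mul]
      rfl
    rw [e]
    refine setIntegral_nonneg measurableSet_Ioi fun s (hs : 0 < s) => ?_
    have hP := (prod_one_sub_exp_neg_mem_Icc (Finset.range m) (fun i => (relRate_pos hp i).le)
      hs.le).1
    simp only [hF]
    rw [Finset.prod_range_succ _ (m + 1), Finset.prod_range_succ _ m]
    set P := ∏ i ∈ Finset.range m, (1 - Real.exp (-(s * (p / (1 - p) ^ (i + 1)))))
    set y : ℝ := s * (p / (1 - p) ^ (m + 1 + 1)) with hy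
    have hy0 : 0 < y := mul_pos hs (relRate_pos hp (m + 1))
    have hx : s * (p / (1 - p) ^ (m + 1)) = (1 - p) * y := by
      rw [hy]
      field_simp
      ring
    rw [hx]
    -- convexity of `exp` between `0` and `y`
    have hconv : Real.exp ((1 - p) * y) ≤ (1 - p) * Real.exp y + p := by
      have := convexOn_exp.2 (Set.mem_univ y) (Set.mem_univ 0) hq.le hp.1.le (by ring)
      simpa using this
    set a := Real.exp (-((1 - p) * y)) with ha
    set b := Real.exp (-y) with hb
    have ha0 : 0 < a := Real.exp_pos _
    have hb0 : 0 < b := Real.exp_pos _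
    have ha1 : a < 1 := Real.exp_lt_one_iff.2 (by nlinarith [mul_pos hq hy0])
    have hb1 : b < 1 := Real.exp_lt_one_iff.2 (by linarith)
    have hab : (1 - a) * b ≤ (1 - p) * (a * (1 - b)) := by
      have e1 : Real.exp ((1 - p) * y) * a = 1 := by rw [ha, ← Real.exp_add]; simp
      have e2 : Real.exp y * b = 1 := by rw [hb, ← Real.exp_add]; simp
      have := mul_le_mul_of_nonneg_right hconv (mul_pos ha0 hb0).le
      linear_combination this - b * e1 + (1 - p) * a * e2
    have hmain : 0 ≤ (1 - p) + (p - 2 * t) * (1 - a) + t ^ 2 * ((1 - a) * (1 - b)) := by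
      have h1b : 0 < 1 - b := by linarith
      -- times `1 - b` this is at least `(1 - a) * (1 - t * (1 - b)) ^ 2`, by `hab`
      refine nonneg_of_mul_nonneg_left (b := 1 - b) ?_ h1b
      nlinarith [mul_nonneg (sub_nonneg.2 ha1.le) (sq_nonneg (1 - t * (1 - b)))]
    have := mul_nonneg (mul_nonneg (Real.exp_pos (-s)).le hP) hmain
    linear_combination this
  have h1 : t * u (m + 2) = u (m + 1) := div_mul_cancel₀ _ hpos.ne'
  have := mul_nonneg key hpos.le
  have h2 : ((1 - p) * u m + (p - 2 * t) * u (m + 1) + t ^ 2 * u (m + 2)) * u (m + 2) =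
    ((1 - p) * u m + p * u (m + 1)) * u (m + 2) - u (m + 1) ^ 2 := by
    linear_combination (-2 * u (m + 1) + t * u (m + 2) + u (m + 1)) * h1
  linarith

end

/-- The bound `u (m + 1) / u (n + 1) - 1 ≤ (1 - p) * (u m / u n - 1)` without divisions. The
hypothesis `hsq` is its case `n = m + 1`. -/
lemma mul_le_of_sq_le {p : ℝ} (hp : p ∈ Set.Ioo (0 : ℝ) 1) {u : ℕ → ℝ} (hpos : ∀ n, 0 < u n)
    (hanti : Antitone u)
    (hsq : ∀ m, u (m + 1) ^ 2 ≤ ((1 - p) * u m + p * u (m + 1)) * u (m + 2)) {m n : ℕ}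
    (hmn : m ≤ n) : u (m + 1) * u n ≤ ((1 - p) * u m + p * u n) * u (n + 1) := by
  induction n, hmn using Nat.le_induction with
  | base => exact le_of_eq (by ring)
  | succ n hmn ih =>
    have hq : 0 < 1 - p := sub_pos.2 hp.2
    have hab : 0 ≤ u m - u n := sub_nonneg.2 (hanti hmn)
    have hbc : 0 ≤ u n - u (n + 1) := sub_nonneg.2 (hanti n.le_succ)
    have hc := hpos (n + 1)
    have hb := hpos n
    have hX : 0 < (1 - p) * u m + p * u n :=
      add_pos (mul_pos hq (hpos m)) (mul_pos hp.1 hb)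
    refine le_of_mul_le_mul_left ?_ hb
    calc u n * (u (m + 1) * u (n + 1)) = u (m + 1) * u n * u (n + 1) := by ring
      _ ≤ ((1 - p) * u m + p * u n) * u (n + 1) * u (n + 1) :=
        mul_le_mul_of_nonneg_right ih hc.le
      _ = ((1 - p) * u m + p * u n) * u (n + 1) ^ 2 := by ring
      _ ≤ ((1 - p) * u m + p * u n) * (((1 - p) * u n + p * u (n + 1)) * u (n + 2)) :=
        mul_le_mul_of_nonneg_left (hsq n) hX.le
      _ ≤ u n * (((1 - p) * u m + p * u (n + 1)) * u (n + 2)) := by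
        have := mul_nonneg (mul_nonneg (mul_nonneg (mul_nonneg hp.1.le hq.le) hab) hbc)
          (hpos (n + 2)).le
        linear_combination this

/-- A quantitative form of Kaluza's theorem: `f k` is the probability that the first renewal
happens at `k + 1`, and its hazard rate at `n + 1` is at least `p * u (n + 1)`. -/
lemma hazard_ge {p : ℝ} (hp : p ∈ Set.Ioo (0 : ℝ) 1) {u f : ℕ → ℝ} (hpos : ∀ n, 0 < u n)
    (hu0 : u 0 = 1) (hanti : Antitone u)
    (hsq : ∀ m, u (m + 1) ^ 2 ≤ ((1 - p) * u m + p * u (m + 1)) * u (m + 2))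
    (hf : ∀ k, 0 ≤ f k) (hren : ∀ n, u (n + 1) = ∑ k ∈ Finset.range (n + 1), f k * u (n - k))
    (n : ℕ) : p * u (n + 1) * (1 - ∑ k ∈ Finset.range n, f k) ≤ f n := by
  cases n with
  | zero =>
    have := hren 0
    simp [hu0] at this ⊢
    rw [this]
    exact mul_le_of_le_one_left (hf 0) hp.2.le
  | succ n =>
    -- the renewal equations at `n + 2` and `n + 1` are compared term by term
    have h1 := hren (n + 1)
    rw [Finset.sum_range_succ, Nat.sub_self, hu0, mul_one] at h1
    have h2 : ∑ k ∈ Finset.range (n + 1), f k * (u (n + 1 - k) - p * u (n + 2)) ≤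
        ∑ k ∈ Finset.range (n + 1), f k * ((1 - p) * (u (n + 2) / u (n + 1)) * u (n - k)) := by
      refine Finset.sum_le_sum fun k hk => mul_le_mul_of_nonneg_left ?_ (hf k)
      have hk' : k ≤ n := Nat.lt_succ_iff.1 (Finset.mem_range.1 hk)
      have := mul_le_of_sq_le hp hpos hanti hsq (m := n - k) (n := n + 1) (by omega)
      rw [show n + 1 - k = n - k + 1 by omega]
      have hne := hpos (n + 1)
      rw [← sub_nonneg] at this ⊢
      have := div_nonneg this hne.le
      convert this using 1
      field_simp
      ring
    have h3 : ∑ k ∈ Finset.range (n + 1), f k * ((1 - p) * (u (n + 2) / u (n + 1)) * u (n - k)) =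
        (1 - p) * u (n + 2) := by
      have : ∀ k, f k * ((1 - p) * (u (n + 2) / u (n + 1)) * u (n - k)) =
        (1 - p) * (u (n + 2) / u (n + 1)) * (f k * u (n - k)) := fun k => by ring
      simp_rw [this]
      rw [← Finset.mul_sum, ← hren n, mul_assoc, div_mul_cancel₀ _ (hpos _).ne']
    have h4 : ∑ k ∈ Finset.range (n + 1), f k * (u (n + 1 - k) - p * u (n + 2)) =
        ∑ k ∈ Finset.range (n + 1), f k * u (n + 1 - k) -
          p * u (n + 2) * ∑ k ∈ Finset.range (n + 1), f k := by
      rw [Finset.mul_sum, ← Finset.sum_sub_distrib]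
      exact Finset.sum_congr rfl fun k _ => by ring
    have h1' : u (n + 2) = ∑ k ∈ Finset.range (n + 1), f k * u (n + 1 - k) + f (n + 1) := h1
    change p * u (n + 2) * _ ≤ _
    linarith

lemma one_sub_sum_le_pow {p q : ℝ} (hp : p ∈ Set.Ioo (0 : ℝ) 1) {u f : ℕ → ℝ}
    (hpos : ∀ n, 0 < u n) (hu0 : u 0 = 1) (hanti : Antitone u)
    (hsq : ∀ m, u (m + 1) ^ 2 ≤ ((1 - p) * u m + p * u (m + 1)) * u (m + 2))
    (hf : ∀ k, 0 ≤ f k) (hren : ∀ n, u (n + 1) = ∑ k ∈ Finset.range (n + 1), f k * u (n - k))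
    (hq : ∀ n, q ≤ u n) (hpq : p * q ≤ 1) (hr : ∀ n, 0 ≤ 1 - ∑ k ∈ Finset.range n, f k) (n : ℕ) :
    1 - ∑ k ∈ Finset.range n, f k ≤ (1 - p * q) ^ n := by
  induction n with
  | zero => simp
  | succ n ih =>
    have h1 := hazard_ge hp hpos hu0 hanti hsq hf hren n
    have h2 := mul_le_mul_of_nonneg_right (mul_le_mul_of_nonneg_left (hq (n + 1)) hp.1.le) (hr n)
    have h3 := mul_le_mul_of_nonneg_right ih (sub_nonneg.2 hpq)
    rw [Finset.sum_range_succ, pow_succ]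
    linarith

/-! ### The lower bound by the constant `b` -/

lemma two_rpow_neg_exp_mem_Ioc {y : ℝ} (hy : 0 ≤ y) :
    (2 : ℝ) ^ (-Real.exp y) ∈ Set.Ioc (0 : ℝ) (1 / 2) := by
  refine ⟨by positivity, ?_⟩
  calc (2 : ℝ) ^ (-Real.exp y) ≤ 2 ^ (-1 : ℝ) :=
        Real.rpow_le_rpow_of_exponent_le one_le_two (by linarith [Real.one_le_exp hy])
    _ = 1 / 2 := by rw [Real.rpow_neg_one]; norm_num

lemma log_one_sub_two_rpow_nonpos {y : ℝ} (hy : 0 ≤ y) :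
    Real.log (1 - (2 : ℝ) ^ (-Real.exp y)) ≤ 0 := by
  have := two_rpow_neg_exp_mem_Ioc hy
  exact Real.log_nonpos (by linarith [this.2]) (by linarith [this.1])

lemma monotoneOn_log_one_sub_two_rpow :
    MonotoneOn (fun y : ℝ => Real.log (1 - (2 : ℝ) ^ (-Real.exp y))) (Set.Ici 0) := by
  intro x hx y _ hxy
  have := two_rpow_neg_exp_mem_Ioc hx
  refine Real.log_le_log (by linarith [this.2]) (sub_le_sub_left ?_ _)
  exact Real.rpow_le_rpow_of_exponent_le one_le_two (neg_le_neg (Real.exp_le_exp.2 hxy))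

lemma integrableOn_log_one_sub_two_rpow :
    IntegrableOn (fun y : ℝ => Real.log (1 - (2 : ℝ) ^ (-Real.exp y))) (Set.Ioi 0) := by
  have hlog : 0 < Real.log 2 := Real.log_pos one_lt_two
  refine Integrable.mono' (g := fun y => 2 * Real.exp (-Real.log 2 * y))
    ((exp_neg_integrableOn_Ioi 0 hlog).const_mul 2) ?_ ?_
  · exact (Measurable.log (by fun_prop)).aestronglyMeasurable
  · filter_upwards [ae_restrict_mem measurableSet_Ioi] with y hy
    have hy0 : 0 ≤ y := le_of_lt hy
    have hz := two_rpow_neg_exp_mem_Ioc hy0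
    set z := (2 : ℝ) ^ (-Real.exp y) with hz'
    have h1 : z ≤ Real.exp (-Real.log 2 * y) := by
      rw [hz', Real.rpow_def_of_pos two_pos]
      refine Real.exp_le_exp.2 ?_
      nlinarith [Real.add_one_le_exp y]
    -- `- log (1 - z) ≤ z / (1 - z) ≤ 2 * z` as `z ≤ 1 / 2`
    have h2 := Real.one_sub_inv_le_log_of_pos (x := 1 - z) (by linarith [hz.2])
    have h3 : (1 - z)⁻¹ ≤ 1 + 2 * z := by
      rw [inv_le_iff_one_le_mul₀ (by linarith [hz.2])]
      nlinarith [hz.1, hz.2]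
    rw [Real.norm_eq_abs, abs_of_nonpos (log_one_sub_two_rpow_nonpos hy0)]
    linarith

lemma log_two_le_blockConst : Real.log 2 ≤ blockConst := by
  have : ∫ y in Set.Ioi (0 : ℝ), Real.log (1 - (2 : ℝ) ^ (-Real.exp y)) ≤ 0 :=
    setIntegral_nonpos measurableSet_Ioi fun y hy => log_one_sub_two_rpow_nonpos (le_of_lt hy)
  unfold blockConst
  linarith

/-- Comparison of a sum with an integral. -/
lemma integral_le_sum_log {p : ℝ} (hp : 0 < p) (n : ℕ) :
    p⁻¹ * ∫ y in Set.Ioi (0 : ℝ), Real.log (1 - (2 : ℝ) ^ (-Real.exp y)) ≤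
      ∑ i ∈ Finset.range n, Real.log (1 - (2 : ℝ) ^ (-Real.exp (p * (i + 1)))) := by
  set L : ℝ → ℝ := fun y => Real.log (1 - (2 : ℝ) ^ (-Real.exp y))
  have hmono : MonotoneOn (fun x => L (p * x)) (Set.Icc (0 : ℝ) (0 + (n : ℝ))) := by
    intro x hx y hy hxy
    exact monotoneOn_log_one_sub_two_rpow (mul_nonneg hp.le hx.1) (mul_nonneg hp.le hy.1)
      (mul_le_mul_of_nonneg_left hxy hp.le)
  have hint : IntegrableOn (fun x => L (p * x)) (Set.Ioi 0) := by
    rw [integrableOn_Ioi_comp_mul_left_iff L 0 hp, mul_zero]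
    exact integrableOn_log_one_sub_two_rpow
  have h1 := hmono.integral_le_sum
  have h2 : ∫ x in Set.Ioi (0 : ℝ), L (p * x) = p⁻¹ * ∫ y in Set.Ioi (0 : ℝ), L y := by
    rw [integral_comp_mul_left_Ioi L 0 hp, mul_zero, smul_eq_mul]
  have h3 : ∫ x in Set.Ioi (0 : ℝ), L (p * x) ≤ ∫ x in (0 : ℝ)..n, L (p * x) := by
    rw [intervalIntegral.integral_of_le n.cast_nonneg, ← neg_le_neg_iff, ← integral_neg,
      ← integral_neg]
    refine setIntegral_mono_set hint.neg ?_ Set.Ioc_subset_Ioi_self.eventuallyLE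
    filter_upwards [ae_restrict_mem measurableSet_Ioi] with x hx
    exact neg_nonneg.2 (log_one_sub_two_rpow_nonpos (mul_nonneg hp.le (le_of_lt hx)))
  rw [← h2]
  refine h3.trans ?_
  simpa using h1

lemma exp_neg_blockConst_div_le {p : ℝ} (hp : p ∈ Set.Ioo (0 : ℝ) 1) (n : ℕ) :
    Real.exp (-blockConst / p) ≤ renewalProb p n := by
  have hq : 0 < 1 - p := sub_pos.2 hp.2
  have hp0 : 0 < p := hp.1
  -- `log 2` is the optimal choice of the time scale
  set s₀ : ℝ := Real.log 2 / p with hs₀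
  have hs₀0 : 0 < s₀ := div_pos (Real.log_pos one_lt_two) hp.1
  have hprod : Real.exp (p⁻¹ * ∫ y in Set.Ioi (0 : ℝ), Real.log (1 - (2 : ℝ) ^ (-Real.exp y))) ≤
      ∏ i ∈ Finset.range n, (1 - Real.exp (-(s₀ * (p / (1 - p) ^ (i + 1))))) := by
    refine (Real.exp_le_exp.2 (integral_le_sum_log hp.1 n)).trans ?_
    rw [Real.exp_sum]
    refine Finset.prod_le_prod (fun i _ => (Real.exp_pos _).le) fun i _ => ?_
    have hy : 0 ≤ p * ((i : ℝ) + 1) := by positivity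
    have hz := two_rpow_neg_exp_mem_Ioc hy
    rw [Real.exp_log (by linarith [hz.2]), Real.rpow_def_of_pos two_pos]
    refine sub_le_sub_left (Real.exp_le_exp.2 ?_) _
    have h1 : Real.exp (p * ((i : ℝ) + 1)) ≤ 1 / (1 - p) ^ (i + 1) := by
      rw [le_div_iff₀ (pow_pos hq _)]
      calc Real.exp (p * ((i : ℝ) + 1)) * (1 - p) ^ (i + 1)
          ≤ Real.exp (p * ((i : ℝ) + 1)) * Real.exp (-p) ^ (i + 1) := by
            gcongr
            linarith [Real.add_one_le_exp (-p)]
        _ = 1 := by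
            rw [← Real.exp_nat_mul, ← Real.exp_add]
            push_cast
            rw [show p * ((i : ℝ) + 1) + (i + 1) * -p = 0 by ring, Real.exp_zero]
    have h2 : s₀ * (p / (1 - p) ^ (i + 1)) = Real.log 2 * (1 / (1 - p) ^ (i + 1)) := by
      rw [hs₀]
      field_simp
    rw [h2, mul_neg]
    exact neg_le_neg (mul_le_mul_of_nonneg_left h1 (Real.log_pos one_lt_two).le)
  set Λ := ∏ i ∈ Finset.range n, (1 - Real.exp (-(s₀ * (p / (1 - p) ^ (i + 1)))))
  calc Real.exp (-blockConst / p) = Real.exp (-s₀) *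
        Real.exp (p⁻¹ * ∫ y in Set.Ioi (0 : ℝ), Real.log (1 - (2 : ℝ) ^ (-Real.exp y))) := by
        rw [← Real.exp_add]
        congr 1
        rw [blockConst, hs₀]
        ring
    _ ≤ Real.exp (-s₀) * Λ := mul_le_mul_of_nonneg_left hprod (Real.exp_pos _).le
    _ = ∫ s in Set.Ioi s₀, Real.exp (-s) * Λ := by
        rw [integral_mul_const, integral_exp_neg_Ioi]
    _ ≤ ∫ s in Set.Ioi s₀, Real.exp (-s) *
          ∏ i ∈ Finset.range n, (1 - Real.exp (-(s * (p / (1 - p) ^ (i + 1))))) := by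
        refine setIntegral_mono_on ((integrableOn_exp_neg_Ioi _).mul_const _)
          ((integrableOn_renewalProb hp n).mono_set (Set.Ioi_subset_Ioi hs₀0.le))
          measurableSet_Ioi fun s (hs : s₀ < s) => ?_
        refine mul_le_mul_of_nonneg_left (Finset.prod_le_prod (fun i _ =>
          (one_sub_exp_neg_mem_Icc (mul_nonneg hs₀0.le (relRate_pos hp i).le)).1) fun i _ => ?_)
          (Real.exp_pos _).le
        exact sub_le_sub_left (Real.exp_le_exp.2 (neg_le_neg
          (mul_le_mul_of_nonneg_right hs.le (relRate_pos hp i).le))) _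
    _ ≤ renewalProb p n := by
        refine setIntegral_mono_set (integrableOn_renewalProb hp n) ?_
          (Set.Ioi_subset_Ioi hs₀0.le).eventuallyLE
        filter_upwards [ae_restrict_mem measurableSet_Ioi] with s hs
        exact mul_nonneg (Real.exp_pos _).le (prod_one_sub_exp_neg_mem_Icc _
          (fun i => (relRate_pos hp i).le) (le_of_lt hs)).1

/-! ### Geometric samples -/

lemma geoMeasure_apply (p : ℝ) (S : Set ℕ) :
    geoMeasure p S = ∑' i : ℕ, ENNReal.ofReal (p * (1 - p) ^ i) * S.indicator 1 (i + 1) := by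
  rw [geoMeasure, Measure.sum_apply _ .of_discrete]
  simp

lemma geoMeasure_singleton_zero (p : ℝ) : geoMeasure p {0} = 0 := by
  simp [geoMeasure_apply]

lemma geoMeasure_singleton_succ (p : ℝ) (i : ℕ) :
    geoMeasure p {i + 1} = ENNReal.ofReal (p * (1 - p) ^ i) := by
  rw [geoMeasure_apply, tsum_eq_single i]
  · simp
  · intro j hj
    simp [hj]

lemma isProbabilityMeasure_geoMeasure {p : ℝ} (hp : p ∈ Set.Ioo (0 : ℝ) 1) :
    IsProbabilityMeasure (geoMeasure p) := by
  have hq : 0 ≤ 1 - p := by linarith [hp.2]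
  have hs := (hasSum_geometric_of_lt_one hq (by linarith [hp.1])).mul_left p
  refine ⟨?_⟩
  rw [geoMeasure_apply]
  simp only [Set.indicator_univ, Pi.one_apply, mul_one]
  rw [← ENNReal.ofReal_tsum_of_nonneg (fun i => mul_nonneg hp.1.le (pow_nonneg hq i)) hs.summable,
    hs.tsum_eq, sub_sub_cancel, mul_inv_cancel₀ hp.1.ne', ENNReal.ofReal_one]

lemma geoMeasure_real_singleton {p : ℝ} (hp : p ∈ Set.Ioo (0 : ℝ) 1) (i : ℕ) :
    (geoMeasure p).real {i + 1} = p * (1 - p) ^ i := by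
  rw [measureReal_def, geoMeasure_singleton_succ, ENNReal.toReal_ofReal
    (mul_nonneg hp.1.le (pow_nonneg (by linarith [hp.2]) i))]

lemma geoMeasure_real_Ioi {p : ℝ} (hp : p ∈ Set.Ioo (0 : ℝ) 1) (n : ℕ) :
    (geoMeasure p).real (Set.Ioi n) = (1 - p) ^ n := by
  have := isProbabilityMeasure_geoMeasure hp
  induction n with
  | zero =>
    have h : (Set.Ioi 0 : Set ℕ) = {0}ᶜ := by ext i; simp [Nat.pos_iff_ne_zero]
    rw [h, probReal_compl_eq_one_sub .of_discrete, measureReal_def, geoMeasure_singleton_zero]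
    simp
  | succ n ih =>
    have h : (Set.Ioi n : Set ℕ) = {n + 1} ∪ Set.Ioi (n + 1) := by ext i; simp
    rw [h, measureReal_union (by simp) .of_discrete, geoMeasure_real_singleton hp] at ih
    rw [pow_succ]
    linarith

lemma geoMeasure_Ioi {p : ℝ} (hp : p ∈ Set.Ioo (0 : ℝ) 1) (n : ℕ) :
    geoMeasure p (Set.Ioi n) = ENNReal.ofReal ((1 - p) ^ n) := by
  have := isProbabilityMeasure_geoMeasure hp
  rw [← geoMeasure_real_Ioi hp, ofReal_measureReal]

lemma geoMeasure_real_Icc {p : ℝ} (hp : p ∈ Set.Ioo (0 : ℝ) 1) (k : ℕ) :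
    (geoMeasure p).real (Set.Icc 1 k) = 1 - (1 - p) ^ k := by
  have := isProbabilityMeasure_geoMeasure hp
  have h : (Set.Ioi 0 : Set ℕ) = Set.Icc 1 k ∪ Set.Ioi k := by ext i; simp; omega
  have hd : Disjoint (Set.Icc 1 k) (Set.Ioi k) :=
    Set.disjoint_left.2 fun i hi hi' => absurd hi.2 (not_le.2 hi')
  have := measureReal_union (μ := geoMeasure p) hd .of_discrete
  rw [← h, geoMeasure_real_Ioi hp, geoMeasure_real_Ioi hp, pow_zero] at this
  linarith

/-- Restricting a `Geo(p)` sample to the letters larger than `k` and subtracting `k` gives a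
`Geo(p)` sample; accordingly the probability depends on `n - k` only. -/
lemma iidLaw_clears_Ioc {p : ℝ} (hp : p ∈ Set.Ioo (0 : ℝ) 1) {k n : ℕ} (hkn : k ≤ n) :
    (iidLaw (geoMeasure p)).real (Clears n ∅ (Finset.Ioc k n)) = renewalProb p (n - k) := by
  have := isProbabilityMeasure_geoMeasure hp
  have hq : 0 < 1 - p := sub_pos.2 hp.2
  have hτ : (geoMeasure p).real (Set.Ioi n) ≠ 0 := by
    rw [geoMeasure_real_Ioi hp]
    exact (pow_pos hq n).ne'
  rw [iidLaw_clears (geoMeasure p) (by simp [measureReal_def, geoMeasure_singleton_zero]) hτ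
    (fun _ => rfl) _ (by simp) (fun i hi => by simp at hi ⊢; omega) (by simp), renewalProb]
  refine integral_congr_ae (Eventually.of_forall fun s => ?_)
  simp only [Finset.sum_empty, mul_zero, neg_zero, Real.exp_zero, one_mul]
  congr 1
  refine Finset.prod_bij' (fun j _ => n - j) (fun i _ => n - i) ?_ ?_ ?_ ?_ ?_
  · intro j hj; simp at hj ⊢; omega
  · intro i hi; simp at hi ⊢; omega
  · intro j hj; simp at hj ⊢; omega
  · intro i hi; simp at hi ⊢; omega
  · intro j hj
    obtain ⟨i, rfl⟩ : ∃ i, j = i + 1 := ⟨j - 1, by simp at hj; omega⟩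
    have hi : i + 1 ≤ n := (Finset.mem_Ioc.1 hj).2
    have e : p * (1 - p) ^ i / (1 - p) ^ n = p / (1 - p) ^ (n - i) := by
      rw [div_eq_div_iff (pow_pos hq n).ne' (pow_pos hq _).ne', mul_assoc, ← pow_add,
        show i + (n - i) = n by omega]
    rw [geoMeasure_real_singleton hp, geoMeasure_real_Ioi hp, e,
      show n - (i + 1) + 1 = n - i by omega]

lemma clears_Ioc_eq {k n : ℕ} (hkn : k ≤ n) :
    Clears n ∅ (Finset.Ioc k n) = ({x | k < x 0} ∩ Clears n ∅ (Finset.Ioc k n)) ∪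
      {x | x 0 ∈ Set.Icc 1 k ∧ (fun i => x (i + 1)) ∈ Clears n ∅ (Finset.Ioc k n)} := by
  ext x
  constructor
  · rintro ⟨m, h1, h2, h3⟩
    by_cases h0 : k < x 0
    · exact Or.inl ⟨h0, m, h1, h2, h3⟩
    · cases m with
      | zero => omega
      | succ m =>
        have h10 := h1 0 (by omega)
        refine Or.inr ⟨⟨by simp at h10; omega, by omega⟩, m, fun i hi => h1 (i + 1) (by omega), h2,
          fun j hj => ?_⟩
        obtain ⟨i, hi, hij⟩ := h3 j hj
        cases i with
        | zero => simp at hj; omega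
        | succ i => exact ⟨i, by omega, hij⟩
  · rintro (⟨-, h⟩ | ⟨h0, m, h1, h2, h3⟩)
    · exact h
    · refine ⟨m + 1, fun i hi => ?_, h2, fun j hj => ?_⟩
      · cases i with
        | zero => simp at h0 ⊢; omega
        | succ i => exact h1 i (by omega)
      · obtain ⟨i, hi, hij⟩ := h3 j hj
        exact ⟨i + 1, by omega, hij⟩

lemma measurableSet_lt_zero_inter_clears (k n : ℕ) (B : Finset ℕ) :
    MeasurableSet ({x | k < x 0} ∩ Clears n ∅ B) :=
  (measurable_pi_apply 0 (MeasurableSet.of_discrete (s := Set.Ioi k))).inter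
    (measurableSet_clears _ _ _)

lemma iidLaw_lt_inter_clears_Ioc {p : ℝ} (hp : p ∈ Set.Ioo (0 : ℝ) 1) {k n : ℕ} (hkn : k ≤ n) :
    (iidLaw (geoMeasure p)).real ({x | k < x 0} ∩ Clears n ∅ (Finset.Ioc k n)) =
      (1 - p) ^ k * renewalProb p (n - k) := by
  have := isProbabilityMeasure_geoMeasure hp
  have hd : Disjoint ({x : ℕ → ℕ | k < x 0} ∩ Clears n ∅ (Finset.Ioc k n))
      {x | x 0 ∈ Set.Icc 1 k ∧ (fun i => x (i + 1)) ∈ Clears n ∅ (Finset.Ioc k n)} := by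
    rw [Set.disjoint_left]
    rintro x ⟨h, -⟩ ⟨h', -⟩
    exact absurd h'.2 (not_le.2 h)
  have h := measureReal_union (μ := iidLaw (geoMeasure p)) hd
    (measurableSet_head_tail _ (measurableSet_clears _ _ _))
  have h2 := congrArg ENNReal.toReal (iidLaw_head_tail (geoMeasure p) (Set.Icc 1 k)
    (measurableSet_clears n ∅ (Finset.Ioc k n)))
  rw [ENNReal.toReal_mul] at h2
  simp only [← measureReal_def] at h2
  rw [← clears_Ioc_eq hkn, h2, geoMeasure_real_Icc hp, iidLaw_clears_Ioc hp hkn] at h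
  linarith

/-! ### Renewals and regeneration -/

/-- The event that `k` is a renewal: the letters before the first one larger than `k` are exactly
`1, …, k`, in some order and with repetitions. -/
def Renewal (k : ℕ) : Set (ℕ → ℕ) := Clears k ∅ (Finset.Icc 1 k)

/-- The event that `k` is the first positive renewal. -/
def FirstRenewal (k : ℕ) : Set (ℕ → ℕ) := {x | x ∈ Renewal k ∧ ∀ j, 1 ≤ j → j < k → x ∉ Renewal j}

/-- The event that there is no renewal in `{1, …, n}`. -/
def NoRenewal (n : ℕ) : Set (ℕ → ℕ) := {x | ∀ j, 1 ≤ j → j ≤ n → x ∉ Renewal j}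

/-- The sequences whose first `m` letters are exactly `1, …, k`, with repetitions, and witness no
positive renewal before `k`. As opposed to `FirstRenewal k`, this depends on these letters only. -/
def FirstRenewalPrefix (k m : ℕ) : Set (ℕ → ℕ) :=
  {x | (∀ i < m, x i ∈ Finset.Icc 1 k) ∧ (∀ j ∈ Finset.Icc 1 k, ∃ i < m, x i = j) ∧
    ∀ j, 1 ≤ j → j < k → ¬ ∃ l < m, (∀ i < l, x i ∈ Finset.Icc 1 j) ∧ j < x l ∧
      ∀ a ∈ Finset.Icc 1 j, ∃ i < l, x i = a}

lemma measurableSet_renewal (k : ℕ) : MeasurableSet (Renewal k) := measurableSet_clears _ _ _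

lemma measurableSet_noRenewal (n : ℕ) : MeasurableSet (NoRenewal n) := by
  refine measurableSet_setOfPred.2 (Measurable.forall fun j => Measurable.imp measurable_const
    (Measurable.imp measurable_const (Measurable.not ?_)))
  exact measurableSet_setOfPred.1 (measurableSet_renewal j)

lemma firstRenewal_eq (k : ℕ) : FirstRenewal (k + 1) = Renewal (k + 1) ∩ NoRenewal k := by
  ext x
  simp [FirstRenewal, NoRenewal]

lemma measurableSet_firstRenewal (k : ℕ) : MeasurableSet (FirstRenewal (k + 1)) := by
  rw [firstRenewal_eq]
  exact (measurableSet_renewal _).inter (measurableSet_noRenewal _)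

lemma measurableSet_firstRenewalPrefix (k m : ℕ) : MeasurableSet (FirstRenewalPrefix k m) := by
  have h : ∀ (i : ℕ) (q : ℕ → Prop), Measurable fun x : ℕ → ℕ => q (x i) := fun i q =>
    (Measurable.of_discrete (f := q)).comp (measurable_pi_apply i)
  have hall : ∀ l b : ℕ, Measurable fun x : ℕ → ℕ => ∀ i < l, x i ∈ Finset.Icc 1 b := fun l b =>
    Measurable.forall fun i => Measurable.imp measurable_const (h i fun a => a ∈ Finset.Icc 1 b)
  have hex : ∀ l b : ℕ, Measurable fun x : ℕ → ℕ => ∀ a ∈ Finset.Icc 1 b, ∃ i < l, x i = a :=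
    fun l b => Measurable.forall fun j => Measurable.imp measurable_const
      (Measurable.exists fun i => Measurable.and measurable_const (h i fun a => a = j))
  refine measurableSet_setOfPred.2 ((hall m k).and ((hex m k).and ?_))
  exact Measurable.forall fun j => Measurable.imp measurable_const (Measurable.imp measurable_const
    (Measurable.not (Measurable.exists fun l => Measurable.and measurable_const
      ((hall l j).and ((h l fun a => j < a).and (hex l j))))))

lemma firstRenewalPrefix_of_agree {k m : ℕ} {x y : ℕ → ℕ} (hxy : ∀ i < m, x i = y i)
    (hx : x ∈ FirstRenewalPrefix k m) : y ∈ FirstRenewalPrefix k m := by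
  obtain ⟨h1, h2, h3⟩ := hx
  refine ⟨fun i hi => hxy i hi ▸ h1 i hi, fun j hj => ?_, fun j hj hjk => ?_⟩
  · obtain ⟨i, hi, rfl⟩ := h2 j hj
    exact ⟨i, hi, (hxy i hi).symm⟩
  · rintro ⟨l, hl, e1, e2, e3⟩
    refine h3 j hj hjk ⟨l, hl, fun i hi => ?_, ?_, fun a ha => ?_⟩
    · rw [hxy i (by omega)]
      exact e1 i hi
    · rwa [hxy l hl]
    · obtain ⟨i, hi, hia⟩ := e3 a ha
      exact ⟨i, hi, (hxy i (by omega)).trans hia⟩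

/-- Decomposition at the position `m` of the first letter larger than the first renewal `k`. -/
lemma firstRenewal_inter_renewal_eq {k n : ℕ} (hk : 1 ≤ k) (hkn : k ≤ n) :
    FirstRenewal k ∩ Renewal n = ⋃ m, (FirstRenewalPrefix k m ∩
      {x | (fun i => x (i + m)) ∈ {y : ℕ → ℕ | k < y 0} ∩ Clears n ∅ (Finset.Ioc k n)}) := by
  ext x
  simp only [Set.mem_iUnion]
  constructor
  · rintro ⟨⟨⟨m, h1, h2, h3⟩, hno⟩, m', h1', h2', h3'⟩
    rw [Finset.sdiff_empty] at h1 h1'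
    have hmm : m ≤ m' := by
      by_contra! hc
      have := (Finset.mem_Icc.1 (h1 m' hc)).2
      omega
    refine ⟨m, ⟨h1, h3, ?_⟩, by simpa using h2, m' - m, fun i hi => ?_, ?_, fun j hj => ?_⟩
    · rintro j hj hjk ⟨l, -, e1, e2, e3⟩
      exact hno j hj hjk ⟨l, by simpa using e1, e2, e3⟩
    · rw [Finset.sdiff_empty]
      exact h1' (i + m) (by omega)
    · change n < x (m' - m + m)
      rwa [Nat.sub_add_cancel hmm]
    · have hj' := Finset.mem_Ioc.1 hj
      obtain ⟨i, hi, hij⟩ := h3' j (Finset.mem_Icc.2 ⟨by omega, hj'.2⟩)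
      have him : m ≤ i := by
        by_contra! hc
        have := (Finset.mem_Icc.1 (h1 i hc)).2
        omega
      refine ⟨i - m, by omega, ?_⟩
      change x (i - m + m) = j
      rwa [Nat.sub_add_cancel him]
  · rintro ⟨m, ⟨h1, h3, hno⟩, h2, l, e1, e2, e3⟩
    have h2' : k < x m := by simpa using h2
    rw [Finset.sdiff_empty] at e1
    refine ⟨⟨⟨m, by simpa using h1, h2', h3⟩, ?_⟩, l + m, fun i hi => ?_, e2, fun j hj => ?_⟩
    · rintro j hj hjk ⟨m', f1, f2, f3⟩
      rw [Finset.sdiff_empty] at f1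
      by_cases hm : m' < m
      · exact hno j hj hjk ⟨m', hm, f1, f2, f3⟩
      · -- the letter `k > j` appears before position `m ≤ m'`
        obtain ⟨i, hi, hik⟩ := h3 k (Finset.mem_Icc.2 ⟨hk, le_rfl⟩)
        have := (Finset.mem_Icc.1 (f1 i (by omega))).2
        omega
    · rw [Finset.sdiff_empty]
      by_cases him : i < m
      · have := Finset.mem_Icc.1 (h1 i him)
        exact Finset.mem_Icc.2 ⟨this.1, this.2.trans hkn⟩
      · have : x (i - m + m) ∈ Finset.Icc 1 n := e1 (i - m) (by omega)
        rwa [Nat.sub_add_cancel (not_lt.1 him)] at this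
    · have hj' := Finset.mem_Icc.1 hj
      by_cases hjk : j ≤ k
      · obtain ⟨i, hi, hij⟩ := h3 j (Finset.mem_Icc.2 ⟨hj'.1, hjk⟩)
        exact ⟨i, by omega, hij⟩
      · obtain ⟨i, hi, hij⟩ := e3 j (Finset.mem_Ioc.2 ⟨by omega, hj'.2⟩)
        exact ⟨i + m, by omega, hij⟩

lemma iidLaw_firstRenewal_inter_renewal (ν : Measure ℕ) [IsProbabilityMeasure ν] {k n : ℕ}
    (hk : 1 ≤ k) (hkn : k ≤ n) :
    iidLaw ν (FirstRenewal k ∩ Renewal n) = (∑' m, iidLaw ν (FirstRenewalPrefix k m)) *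
      iidLaw ν ({y : ℕ → ℕ | k < y 0} ∩ Clears n ∅ (Finset.Ioc k n)) := by
  have hE := measurableSet_lt_zero_inter_clears k n (Finset.Ioc k n)
  rw [firstRenewal_inter_renewal_eq hk hkn, measure_iUnion, ← ENNReal.tsum_mul_right]
  · refine tsum_congr fun m => ?_
    exact iidLaw_prefix_inter_shift ν m (measurableSet_firstRenewalPrefix k m) hE
      fun x y hxy hx => firstRenewalPrefix_of_agree hxy hx
  · refine (pairwise_disjoint_on _).2 fun m m' hm => Set.disjoint_left.2 ?_
    rintro x ⟨-, h, -⟩ ⟨⟨h', -⟩, -⟩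
    have h2 : k < x m := by simpa using h
    exact absurd (Finset.mem_Icc.1 (h' m hm)).2 (not_le.2 h2)
  · intro m
    exact (measurableSet_firstRenewalPrefix k m).inter
      ((measurable_pi_iff.2 fun i => measurable_pi_apply (i + m)) hE)

/-- Regeneration: given that `k` is the first renewal, `n` is a renewal with probability
`renewalProb p (n - k)`. -/
lemma iidLaw_real_firstRenewal_inter_renewal {p : ℝ} (hp : p ∈ Set.Ioo (0 : ℝ) 1) {k n : ℕ}
    (hk : 1 ≤ k) (hkn : k ≤ n) :
    (iidLaw (geoMeasure p)).real (FirstRenewal k ∩ Renewal n) =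
      (iidLaw (geoMeasure p)).real (FirstRenewal k) * renewalProb p (n - k) := by
  have := isProbabilityMeasure_geoMeasure hp
  have hself : FirstRenewal k = FirstRenewal k ∩ Renewal k :=
    (Set.inter_eq_left.2 fun x hx => hx.1).symm
  conv_rhs => rw [hself]
  simp only [measureReal_def]
  rw [iidLaw_firstRenewal_inter_renewal _ hk hkn, iidLaw_firstRenewal_inter_renewal _ hk le_rfl,
    ENNReal.toReal_mul, ENNReal.toReal_mul]
  simp only [← measureReal_def]
  rw [iidLaw_lt_inter_clears_Ioc hp hkn, iidLaw_lt_inter_clears_Ioc hp le_rfl, Nat.sub_self,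
    renewalProb_zero]
  ring

lemma disjoint_firstRenewal {j k : ℕ} (hj : 1 ≤ j) (hk : 1 ≤ k) (hjk : j ≠ k) :
    Disjoint (FirstRenewal j) (FirstRenewal k) := by
  refine Set.disjoint_left.2 fun x hx hx' => ?_
  rcases lt_or_gt_of_ne hjk with h | h
  · exact hx'.2 j hj h hx.1
  · exact hx.2 k hk h hx'.1

lemma exists_firstRenewal {n : ℕ} {x : ℕ → ℕ} (hn : x ∉ NoRenewal n) :
    ∃ k < n, x ∈ FirstRenewal (k + 1) := by
  classical
  have h : ∃ j, 1 ≤ j ∧ j ≤ n ∧ x ∈ Renewal j := by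
    simpa [NoRenewal] using hn
  obtain ⟨h1, h2, h3⟩ := Nat.find_spec h
  refine ⟨Nat.find h - 1, by omega, ?_⟩
  rw [Nat.sub_add_cancel h1]
  exact ⟨h3, fun j hj hjk hx => Nat.find_min h hjk ⟨hj, by omega, hx⟩⟩

lemma renewalProb_succ_eq_sum {p : ℝ} (hp : p ∈ Set.Ioo (0 : ℝ) 1) (n : ℕ) :
    renewalProb p (n + 1) = ∑ k ∈ Finset.range (n + 1),
      (iidLaw (geoMeasure p)).real (FirstRenewal (k + 1)) * renewalProb p (n - k) := by
  have := isProbabilityMeasure_geoMeasure hp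
  have hset : Renewal (n + 1) =
      ⋃ k ∈ Finset.range (n + 1), FirstRenewal (k + 1) ∩ Renewal (n + 1) := by
    ext x
    simp only [Set.mem_iUnion, Finset.mem_range]
    constructor
    · intro hx
      obtain ⟨k, hk, hkx⟩ := exists_firstRenewal (n := n + 1) (x := x)
        fun h => h (n + 1) (by omega) le_rfl hx
      exact ⟨k, hk, hkx, hx⟩
    · rintro ⟨k, -, -, hx⟩
      exact hx
  have hu : (iidLaw (geoMeasure p)).real (Renewal (n + 1)) = renewalProb p (n + 1) :=
    iidLaw_clears_Ioc hp (k := 0) (n := n + 1) (Nat.zero_le _)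
  rw [← hu, hset, measureReal_biUnion_finset]
  · refine Finset.sum_congr rfl fun k hk => ?_
    have hk' := Finset.mem_range.1 hk
    rw [iidLaw_real_firstRenewal_inter_renewal hp (by omega) (by omega), Nat.add_sub_add_right]
  · intro j _ k _ hjk
    exact (disjoint_firstRenewal (by omega) (by omega) (by omega)).mono Set.inter_subset_left
      Set.inter_subset_left
  · exact fun k _ => (measurableSet_firstRenewal k).inter (measurableSet_renewal _)

lemma iidLaw_noRenewal_eq (ν : Measure ℕ) [IsProbabilityMeasure ν] (n : ℕ) :
    (iidLaw ν).real (NoRenewal n) =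
      1 - ∑ k ∈ Finset.range n, (iidLaw ν).real (FirstRenewal (k + 1)) := by
  have hset : (NoRenewal n)ᶜ = ⋃ k ∈ Finset.range n, FirstRenewal (k + 1) := by
    ext x
    simp only [Set.mem_iUnion, Finset.mem_range, Set.mem_compl_iff, exists_prop]
    constructor
    · exact exists_firstRenewal
    · rintro ⟨k, hk, hx⟩ h
      exact h (k + 1) (by omega) (by omega) hx.1
  rw [← measureReal_biUnion_finset, ← hset, probReal_compl_eq_one_sub (measurableSet_noRenewal n)]
  · ring
  · intro j _ k _ hjk
    exact disjoint_firstRenewal (by omega) (by omega) (by omega)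
  · exact fun k _ => measurableSet_firstRenewal k

lemma mul_exp_neg_blockConst_mem_Ioo {p : ℝ} (hp : p ∈ Set.Ioo (0 : ℝ) 1) :
    p * Real.exp (-blockConst / p) ∈ Set.Ioo (0 : ℝ) 1 := by
  have hb : 0 ≤ blockConst := (Real.log_pos one_lt_two).le.trans log_two_le_blockConst
  refine ⟨mul_pos hp.1 (Real.exp_pos _), ?_⟩
  have : Real.exp (-blockConst / p) ≤ 1 :=
    Real.exp_le_one_iff.2 (div_nonpos_of_nonpos_of_nonneg (neg_nonpos.2 hb) hp.1.le)
  exact (mul_le_of_le_one_right hp.1.le this).trans_lt hp.2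

lemma iidLaw_noRenewal_le {p : ℝ} (hp : p ∈ Set.Ioo (0 : ℝ) 1) (n : ℕ) :
    (iidLaw (geoMeasure p)).real (NoRenewal n) ≤ (1 - p * Real.exp (-blockConst / p)) ^ n := by
  have := isProbabilityMeasure_geoMeasure hp
  have hlow := exp_neg_blockConst_div_le hp
  have hpos : ∀ n, 0 < renewalProb p n := fun n => (Real.exp_pos _).trans_le (hlow n)
  rw [iidLaw_noRenewal_eq]
  refine one_sub_sum_le_pow hp hpos (renewalProb_zero p)
    (antitone_nat_of_succ_le (renewalProb_succ_le hp)) (fun m => renewalProb_sq_le hp m (hpos _))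
    (fun _ => measureReal_nonneg) (renewalProb_succ_eq_sum hp) hlow
    (mul_exp_neg_blockConst_mem_Ioo hp).2.le (fun n => ?_) n
  rw [← iidLaw_noRenewal_eq]
  exact measureReal_nonneg

/-! ### From renewals to the first block size -/

/-- At a renewal `k` the values in order of first appearance begin with a permutation of
`{1, …, k}`. -/
lemma bijOn_appearancePerm {k : ℕ} {x : ℕ → ℕ} (hx : x ∈ Renewal k) :
    Set.BijOn (appearancePerm x) (Set.Icc 1 k) (Set.Icc 1 k) := by
  classical
  obtain ⟨m, h1, -, h3⟩ := hx
  rw [Finset.sdiff_empty] at h1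
  set new : ℕ → Prop := fun n => ∀ l < n, x l ≠ x n
  have hinj : ∀ a b, new a → new b → x a = x b → a = b := by
    intro a b ha hb hab
    rcases lt_trichotomy a b with h | h | h
    · exact absurd hab (hb a h)
    · exact h
    · exact absurd hab.symm (ha b h)
  have hfirst : ∀ v ∈ Finset.Icc 1 k, ∃ n < m, new n ∧ x n = v := by
    intro v hv
    have hex : ∃ n, x n = v := (h3 v hv).imp fun n hn => hn.2
    obtain ⟨i, hi, hiv⟩ := h3 v hv
    refine ⟨Nat.find hex, (Nat.find_min' hex hiv).trans_lt hi, fun l hl hlx => ?_,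
      Nat.find_spec hex⟩
    exact Nat.find_min hex hl (hlx.trans (Nat.find_spec hex))
  have hcount : Nat.count new m = k := by
    have : ((Finset.range m).filter new).image x = Finset.Icc 1 k := by
      ext v
      simp only [Finset.mem_image, Finset.mem_filter, Finset.mem_range]
      constructor
      · rintro ⟨n, ⟨hn, -⟩, rfl⟩
        exact h1 n hn
      · intro hv
        obtain ⟨n, hn, hnn, hnv⟩ := hfirst v hv
        exact ⟨n, ⟨hn, hnn⟩, hnv⟩
    rw [Nat.count_eq_card_filter_range, ← Finset.card_image_of_injOn (f := x), this,
      Nat.card_Icc, Nat.add_sub_cancel]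
    intro a ha b hb hab
    exact hinj a b (Finset.mem_filter.1 ha).2 (Finset.mem_filter.1 hb).2 hab
  have hlt : ∀ i ∈ Set.Icc 1 k, i - 1 < Nat.count new m := by
    rintro i ⟨hi1, hik⟩
    omega
  have hcard : ∀ i ∈ Set.Icc 1 k, ∀ hf : (Set.ofPred new).Finite, i - 1 < hf.toFinset.card :=
    fun i hi hf => (hlt i hi).trans_le (Nat.count_le_card hf m)
  refine ⟨fun i hi => ?_, fun i hi j hj hij => ?_, fun v hv => ?_⟩
  · exact Finset.mem_Icc.1 (h1 _ (Nat.nth_lt_of_lt_count (hlt i hi)))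
  · have := hinj _ _ (Nat.nth_mem _ (hcard i hi)) (Nat.nth_mem _ (hcard j hj)) hij
    have h := congrArg (Nat.count new) this
    rw [Nat.count_nth (hcard i hi), Nat.count_nth (hcard j hj)] at h
    have := hi.1
    have := hj.1
    omega
  · obtain ⟨n, hn, hnn, hnv⟩ := hfirst v (by simpa using hv)
    have := Nat.count_strict_mono hnn hn
    refine ⟨Nat.count new n + 1, ⟨by omega, by omega⟩, ?_⟩
    change x (Nat.nth new (Nat.count new n + 1 - 1)) = v
    rw [Nat.add_sub_cancel, Nat.nth_count hnn, hnv]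

lemma mem_noRenewal_of_lt_firstBlockSize {n : ℕ} {x : ℕ → ℕ}
    (h : (n : ℕ∞) < firstBlockSize (appearancePerm x)) : x ∈ NoRenewal n := by
  intro j hj hjn hx
  have : firstBlockSize (appearancePerm x) ≤ (j : ℕ∞) :=
    iInf₂_le j ⟨hj, bijOn_appearancePerm hx⟩
  exact absurd (h.trans_le this) (not_lt.2 (by exact_mod_cast hjn))

/-- The number of `n` with no renewal in `{1, …, n}`, that is, the first positive renewal: a
measurable majorant of the first block size. -/
noncomputable def renewalBound (x : ℕ → ℕ) : ℝ≥0∞ :=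
  ∑' n : ℕ, (NoRenewal n).indicator 1 x

lemma measurable_renewalBound : Measurable renewalBound :=
  Measurable.tsum fun n => measurable_one.indicator (measurableSet_noRenewal n)

lemma firstBlockSize_le_renewalBound (x : ℕ → ℕ) :
    (firstBlockSize (appearancePerm x) : ℝ≥0∞) ≤ renewalBound x := by
  have hN : ∀ N : ℕ, (N : ℕ∞) ≤ firstBlockSize (appearancePerm x) →
      (N : ℝ≥0∞) ≤ renewalBound x := by
    intro N hN
    calc (N : ℝ≥0∞) = ∑ n ∈ Finset.range N, (NoRenewal n).indicator 1 x := by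
          rw [Finset.sum_congr rfl fun n hn => Set.indicator_of_mem
            (mem_noRenewal_of_lt_firstBlockSize (lt_of_lt_of_le
              (by exact_mod_cast Finset.mem_range.1 hn) hN)) _]
          simp
      _ ≤ renewalBound x := ENNReal.sum_le_tsum _
  cases hK : firstBlockSize (appearancePerm x) with
  | top =>
    rw [hK] at hN
    have : renewalBound x = ∞ := ENNReal.eq_top_of_forall_nnreal_le fun r => by
      obtain ⟨N, hrN⟩ := exists_nat_ge r
      exact le_trans (by exact_mod_cast hrN) (hN N le_top)
    simp [this]
  | coe N =>
    simpa using hN N hK.ge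

section

variable {Ω : Type*} [MeasurableSpace Ω] {P : Measure Ω} {X : ℕ → Ω → ℕ} {p : ℝ}

lemma IsIIDSample.hasLaw {ν : Measure ℕ} (h : IsIIDSample ν P X) :
    HasLaw (fun ω n => X n ω) (iidLaw ν) P :=
  iIndepFun.hasLaw_infinitePi h.law h.indep (aemeasurable_pi_iff.2 fun n => (h.law n).aemeasurable)

lemma IsIIDSample.measure_noRenewal_le (hp : p ∈ Set.Ioo (0 : ℝ) 1)
    (h : IsIIDSample (geoMeasure p) P X) (n : ℕ) :
    P {ω | (fun i => X i ω) ∈ NoRenewal n} ≤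
      ENNReal.ofReal ((1 - p * Real.exp (-blockConst / p)) ^ n) := by
  have := isProbabilityMeasure_geoMeasure hp
  rw [h.hasLaw.measure_eq (p := fun x => x ∈ NoRenewal n) (measurableSet_noRenewal n)]
  change iidLaw (geoMeasure p) (NoRenewal n) ≤ _
  rw [← ofReal_measureReal]
  exact ENNReal.ofReal_le_ofReal (iidLaw_noRenewal_le hp n)

lemma IsIIDSample.stochDominated_blockSize (hp : p ∈ Set.Ioo (0 : ℝ) 1)
    (h : IsIIDSample (geoMeasure p) P X) :
    StochDominated P (blockSize X) (geoMeasure (p * Real.exp (-blockConst / p)))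
      (fun k : ℕ => (k : ℕ∞)) := by
  intro t
  cases t with
  | top => simp
  | coe n =>
    have e : {k : ℕ | (n : ℕ∞) < (k : ℕ∞)} = Set.Ioi n := by
      ext k
      simp
    rw [e, geoMeasure_Ioi (mul_exp_neg_blockConst_mem_Ioo hp)]
    have hsub : {ω | (n : ℕ∞) < blockSize X ω} ⊆ {ω | (fun i => X i ω) ∈ NoRenewal n} :=
      fun ω hω => mem_noRenewal_of_lt_firstBlockSize hω
    exact (measure_mono hsub).trans (h.measure_noRenewal_le hp n)

lemma IsIIDSample.lintegral_renewalBound_le (hp : p ∈ Set.Ioo (0 : ℝ) 1)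
    (h : IsIIDSample (geoMeasure p) P X) :
    ∫⁻ ω, renewalBound (fun n => X n ω) ∂P ≤
      ENNReal.ofReal (1 / p * Real.exp (blockConst / p)) := by
  have hq := mul_exp_neg_blockConst_mem_Ioo hp
  have hq1 : 0 ≤ 1 - p * Real.exp (-blockConst / p) := by linarith [hq.2]
  have hgeo := hasSum_geometric_of_lt_one hq1 (by linarith [hq.1])
  have hae := h.hasLaw.aemeasurable
  have e : ∀ n, ∫⁻ ω, (NoRenewal n).indicator (1 : (ℕ → ℕ) → ℝ≥0∞) (fun i => X i ω) ∂P =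
      P {ω | (fun i => X i ω) ∈ NoRenewal n} := by
    intro n
    exact lintegral_indicator_one₀ (hae.nullMeasurableSet_preimage (measurableSet_noRenewal n))
  calc ∫⁻ ω, renewalBound (fun n => X n ω) ∂P
      = ∑' n, P {ω | (fun i => X i ω) ∈ NoRenewal n} := by
        simp only [renewalBound]
        exact (lintegral_tsum fun n => (measurable_one.indicator
          (measurableSet_noRenewal n)).comp_aemeasurable hae).trans (tsum_congr e)
    _ ≤ ∑' n : ℕ, ENNReal.ofReal ((1 - p * Real.exp (-blockConst / p)) ^ n) :=
        ENNReal.tsum_le_tsum fun n => h.measure_noRenewal_le hp n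
    _ = ENNReal.ofReal (1 / p * Real.exp (blockConst / p)) := by
        rw [← ENNReal.ofReal_tsum_of_nonneg (fun n => pow_nonneg hq1 n) hgeo.summable, hgeo.tsum_eq,
          sub_sub_cancel, mul_inv, ← Real.exp_neg, one_div, neg_div, neg_neg]

lemma IsIIDSample.measure_exp_lt_blockSize_le (hp : p ∈ Set.Ioo (0 : ℝ) 1)
    (h : IsIIDSample (geoMeasure p) P X) (ε : ℝ) :
    P {ω | ENNReal.ofReal (Real.exp ((blockConst + ε) / p)) < (blockSize X ω : ℝ≥0∞)} ≤
      ENNReal.ofReal (1 / p * Real.exp (-(ε / p))) := by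
  set a := Real.exp ((blockConst + ε) / p)
  have ha : 0 < a := Real.exp_pos _
  have h1 := meas_ge_le_lintegral_div (μ := P) (f := fun ω => renewalBound fun n => X n ω)
    (measurable_renewalBound.comp_aemeasurable h.hasLaw.aemeasurable)
    (ε := ENNReal.ofReal a) (by simpa using ha) ENNReal.ofReal_ne_top
  calc P {ω | ENNReal.ofReal a < (blockSize X ω : ℝ≥0∞)}
      ≤ P {ω | ENNReal.ofReal a ≤ renewalBound fun n => X n ω} :=
        measure_mono fun ω hω => (le_of_lt hω).trans (firstBlockSize_le_renewalBound _)
    _ ≤ (∫⁻ ω, renewalBound (fun n => X n ω) ∂P) / ENNReal.ofReal a := h1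
    _ ≤ ENNReal.ofReal (1 / p * Real.exp (blockConst / p)) / ENNReal.ofReal a :=
        ENNReal.div_le_div_right (h.lintegral_renewalBound_le hp) _
    _ = ENNReal.ofReal (1 / p * Real.exp (-(ε / p))) := by
        rw [← ENNReal.ofReal_div_of_pos ha, mul_div_assoc, ← Real.exp_sub]
        congr 3
        ring

end

theorem theorem1 :
    IntegrableOn (fun y : ℝ => Real.log (1 - (2 : ℝ) ^ (-Real.exp y))) (Set.Ioi 0) ∧
    (∀ p ∈ Set.Ioo (0 : ℝ) 1, ∀ (Ω : Type*) [MeasurableSpace Ω] (P : Measure Ω)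
      (X : ℕ → Ω → ℕ), IsIIDSample (geoMeasure p) P X →
        StochDominated P (blockSize X)
          (geoMeasure (p * Real.exp (-blockConst / p))) (fun k : ℕ => (k : ℕ∞)) ∧
        ∫⁻ ω, (blockSize X ω : ℝ≥0∞) ∂P ≤ ENNReal.ofReal (1 / p * Real.exp (blockConst / p))) ∧
    (∀ (Ω : ℝ → Type*) [∀ p, MeasurableSpace (Ω p)] (P : ∀ p, Measure (Ω p))
      (X : ∀ p, ℕ → Ω p → ℕ),
      (∀ p ∈ Set.Ioo (0 : ℝ) 1, IsIIDSample (geoMeasure p) (P p) (X p)) →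
      ∀ ε : ℝ, 0 < ε →
        Tendsto (fun p : ℝ => P p {ω | ENNReal.ofReal (Real.exp ((blockConst + ε) / p)) <
          (blockSize (X p) ω : ℝ≥0∞)}) (𝓝[>] 0) (𝓝 0)) := by
  refine ⟨integrableOn_log_one_sub_two_rpow, ?_, ?_⟩
  · intro p hp Ω _ P X h
    exact ⟨h.stochDominated_blockSize hp, (lintegral_mono fun ω =>
      firstBlockSize_le_renewalBound _).trans (h.lintegral_renewalBound_le hp)⟩
  · intro Ω _ P X h ε hε
    have hlim : Tendsto (fun p : ℝ => ENNReal.ofReal (1 / p * Real.exp (-(ε / p)))) (𝓝[>] 0)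
        (𝓝 0) := by
      rw [← ENNReal.ofReal_zero]
      refine ENNReal.tendsto_ofReal ?_
      have h1 := (Real.tendsto_pow_mul_exp_neg_atTop_nhds_zero 1).comp
        (tendsto_inv_nhdsGT_zero (𝕜 := ℝ) |>.const_mul_atTop hε)
      have h2 := h1.const_mul ε⁻¹
      rw [mul_zero] at h2
      refine h2.congr fun p => ?_
      simp only [Function.comp, pow_one, div_eq_mul_inv, one_mul]
      rw [← mul_assoc, ← mul_assoc, inv_mul_cancel₀ hε.ne', one_mul]
    refine tendsto_of_tendsto_of_tendsto_of_le_of_le' tendsto_const_nhds hlim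
      (Eventually.of_forall fun _ => zero_le) ?_
    filter_upwards [Ioo_mem_nhdsGT (zero_lt_one (α := ℝ))] with p hp
    exact (h p hp).measure_exp_lt_blockSize_le hp ε
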